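/- All categories, functors and natural transformations are enriched over the cartesian closed category $\mathrm{Pos}$ of posets and monotone maps: hom-sets are partially ordered, composition is monotone, and functors are monotone on hom-posets. Given a small category $\mathcal D$, a weight $W\colon\mathcal D^{\mathrm{op}}\to\mathrm{Pos}$ and a diagram $D\colon\mathcal D\to\mathcal L$, the colimit of $D$ weighted by $W$ is an object $C=\operatorname{colim}_W D$ of $\mathcal L$ with an isomorphism of posets $\mathcal L(C,X)\cong[\mathcal D^{\mathrm{op}},\mathrm{Pos}](W,\mathcal L(D-,X))$ natural in $X\in\mathcal L$. The weight $W$ is *sifted* if $W$-weighted colimits of diagrams in $\mathrm{Pos}$ commute with finite products (including the empty product); a *sifted colimit* is a weighted colimit with a sifted weight. Let $\Sigma$ be a finitary signature. A *variety of ordered algebras* is a full subcategory $\mathcal K$ of the category of ordered $\Sigma$-algebras (posets with monotone operations, and monotone homomorphisms, ordered pointwise) specified by a set of inequations $s\le t$ between terms. **Theorem.** Let $\mathcal K$ be a variety of ordered algebras and $\mathcal P$ its full subcategory of all free algebras on finite discrete posets (closed under isomorphism). Then $\mathcal K$ is the free completion of $\mathcal P$ under sifted colimits. That is, $\mathcal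 K$ has sifted colimits and, for every category $\mathcal L$ with sifted colimits: 1. every functor $F\colon\mathcal P\to\mathcal L$ has an extension (up to natural isomorphism) $F'\colon\mathcal K\to\mathcal L$ preserving sifted colimits, and $F'$ is unique up to natural isomorphism; 2. restriction to $\mathcal P$ is an equivalence from the category of functors $\mathcal K\to\mathcal L$ preserving sifted colimits, with natural transformations ordered pointwise, to the category of all functors $\mathcal P\to\mathcal L$. Moreover, $\mathcal K$ is the closure of $\mathcal P$ under reflexive coinserters, filtered colimits and split coequalizers: every class of objects of $\mathcal K$ that contains $\mathcal P$ and is closed under these three constructions in $\mathcal K$ contains all objects of $\mathcal K$. Here a *coinserter* of $u_0,u_1\colon U\to X$ is a morphism $f\colon X\to Y$ with $fu_0\le fu_1$ such that every $h\colon X\to Z$ with $hu_0\le hu_1$ factorizes through $f$, and $gf\le g'f$ implies $g\le g'$ for all $g,g'\colon Y\to Z$; it is *reflexive* if there is $d\colon X\to U$ with $u_0d=u_1d=\mathrm{id}_X$. Filtered colimits are those with weight constantly $1$ over a small category whose underlying category is filtered. -/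

import Mathlib

open CategoryTheory

namespace PosCat

/-! ## Categories enriched over posets -/

section Enriched

universe w v w' v' u

/-- A category enriched over the cartesian closed category of posets: every hom-set carries
a partial order and composition is monotone in both variables. -/
class PosEnriched (C : Type v) [Category.{w} C] where
  homOrder (X Y : C) : PartialOrder (X ⟶ Y)
  comp_le_comp {X Y Z : C} {f f' : X ⟶ Y} {g g' : Y ⟶ Z} :
    (homOrder X Y).le f f' → (homOrder Y Z).le g g' → (homOrder X Z).le (f ≫ g) (f' ≫ g')

instance {C : Type v} [Category.{w} C] [PosEnriched C] (X Y : C) : PartialOrder (X ⟶ Y) :=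
  PosEnriched.homOrder X Y

/-- The opposite of an enriched category, with the same order on hom-sets. -/
instance {C : Type v} [Category.{w} C] [PosEnriched C] : PosEnriched Cᵒᵖ where
  homOrder _ _ := PartialOrder.lift Quiver.Hom.unop Quiver.Hom.unop_inj
  comp_le_comp h h' := PosEnriched.comp_le_comp h' h

/-- A full subcategory, with the induced order on hom-sets. -/
instance {C : Type v} [Category.{w} C] [PosEnriched C] (P : ObjectProperty C) :
    PosEnriched P.FullSubcategory where
  homOrder _ _ := PartialOrder.lift (fun f => f.hom) (fun _ _ h => P.hom_ext h)
  comp_le_comp h h' := PosEnriched.comp_le_comp (C := C) h h'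

/-- The category of posets and monotone maps, with the pointwise order on hom-sets. -/
instance : PosEnriched PartOrd.{u} where
  homOrder _ _ := PartialOrder.lift (fun f => f.hom) (fun _ _ h => PartOrd.hom_ext h)
  comp_le_comp {_ _ _ _ f' g _} h h' := fun x => (g.hom.monotone (h x)).trans (h' (f'.hom x))

/-- An enriched functor: a functor that is monotone on hom-posets.
(Enriched natural transformations are just the ordinary ones.) -/
class PosFunctor {C : Type v} [Category.{w} C] [PosEnriched C]
    {C' : Type v'} [Category.{w'} C'] [PosEnriched C'] (F : C ⥤ C') : Prop where
  map_le {X Y : C} {f g : X ⟶ Y} : f ≤ g → F.map f ≤ F.map g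

end Enriched

/-! ## Weighted colimits -/

section Weighted

universe u w v w' v'

variable {D : Type u} [Category.{u} D] {C : Type v} [Category.{w} C] [PosEnriched C]

/-- A cocone with vertex `pt` over the diagram `G`, weighted by `W`: a natural transformation
from `W` to `C(G -, pt)`, that is, a natural family of monotone maps `W d → C(G d, pt)`. -/
structure WeightedCocone (W : Dᵒᵖ ⥤ PartOrd.{u}) (G : D ⥤ C) where
  pt : C
  leg (d : D) : W.obj (Opposite.op d) → (G.obj d ⟶ pt)
  leg_mono (d : D) : Monotone (leg d)
  naturality {d d' : D} (f : d ⟶ d') (x : W.obj (Opposite.op d')) :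
    leg d (W.map f.op x) = G.map f ≫ leg d' x

/-- `c` exhibits its vertex as the weighted colimit of `G`: for every object `X`, composition
with the legs is an isomorphism of posets from `C(c.pt, X)` to the poset `[Dᵒᵖ, Pos](W, C(G -, X))`
of weighted cocones with vertex `X`, ordered pointwise. -/
structure WeightedCocone.IsColimit {W : Dᵒᵖ ⥤ PartOrd.{u}} {G : D ⥤ C}
    (c : WeightedCocone W G) : Prop where
  exists_desc (s : WeightedCocone W G) :
    ∃ g : c.pt ⟶ s.pt, ∀ (d : D) (x : W.obj (Opposite.op d)), c.leg d x ≫ g = s.leg d x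
  le_of_legs {X : C} (g g' : c.pt ⟶ X) :
    (∀ (d : D) (x : W.obj (Opposite.op d)), c.leg d x ≫ g ≤ c.leg d x ≫ g') → g ≤ g'

/-- The image of a weighted cocone under an enriched functor. -/
def WeightedCocone.map {C' : Type v'} [Category.{w'} C'] [PosEnriched C']
    {W : Dᵒᵖ ⥤ PartOrd.{u}} {G : D ⥤ C} (c : WeightedCocone W G) (F : C ⥤ C') [PosFunctor F] :
    WeightedCocone W (G ⋙ F) where
  pt := F.obj c.pt
  leg d x := F.map (c.leg d x)
  leg_mono d _ _ h := PosFunctor.map_le (c.leg_mono d h)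
  naturality f x := by simp [c.naturality f x]

end Weighted

/-! ## Sifted weights and sifted colimits -/

section Sifted

universe u w v w' v'

variable {D : Type u} [Category.{u} D]

/-- The pointwise product of two diagrams of posets. -/
def prodDiagram (G₁ G₂ : D ⥤ PartOrd.{u}) : D ⥤ PartOrd.{u} where
  obj d := PartOrd.of (G₁.obj d × G₂.obj d)
  map f := PartOrd.ofHom ((G₁.map f).hom.prodMap (G₂.map f).hom)

/-- The cocone over the product of two diagrams of posets whose legs are the products of
the given legs. It induces the canonical morphism
`colim_W (G₁ × G₂) ⟶ colim_W G₁ × colim_W G₂`. -/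
def prodCocone {W : Dᵒᵖ ⥤ PartOrd.{u}} {G₁ G₂ : D ⥤ PartOrd.{u}}
    (c₁ : WeightedCocone W G₁) (c₂ : WeightedCocone W G₂) :
    WeightedCocone W (prodDiagram G₁ G₂) where
  pt := PartOrd.of (c₁.pt × c₂.pt)
  leg d x := PartOrd.ofHom ((c₁.leg d x).hom.prodMap (c₂.leg d x).hom)
  leg_mono d _ _ h := fun p => ⟨c₁.leg_mono d h p.1, c₂.leg_mono d h p.2⟩
  naturality f x := by
    rw [c₁.naturality f x, c₂.naturality f x]
    rfl

/-- The constant diagram on the one-element poset, i.e. the empty product of diagrams. -/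
abbrev unitDiagram (D : Type u) [Category.{u} D] : D ⥤ PartOrd.{u} :=
  (Functor.const D).obj (PartOrd.of PUnit)

/-- The unique cocone over the constant diagram `1` with vertex `1`. It induces the canonical
morphism `colim_W 1 ⟶ 1`. -/
def unitCocone (W : Dᵒᵖ ⥤ PartOrd.{u}) : WeightedCocone W (unitDiagram D) where
  pt := PartOrd.of PUnit
  leg _ _ := 𝟙 (PartOrd.of PUnit)
  leg_mono _ _ _ _ := le_rfl
  naturality _ _ := rfl

variable [PosEnriched D]

/-- A weight `W : Dᵒᵖ ⥤ Pos` (an enriched functor on a small enriched category) is sifted if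
`W`-weighted colimits of diagrams in posets commute with finite products, i.e. with the empty
product and with binary products. The canonical morphism is an isomorphism exactly when the
product of the colimit cocones is again a colimit cocone. -/
structure IsSifted (W : Dᵒᵖ ⥤ PartOrd.{u}) : Prop where
  posFunctor : PosFunctor W
  unit : (unitCocone W).IsColimit
  prod (G₁ G₂ : D ⥤ PartOrd.{u}) [PosFunctor G₁] [PosFunctor G₂]
    (c₁ : WeightedCocone W G₁) (c₂ : WeightedCocone W G₂) :
    c₁.IsColimit → c₂.IsColimit → (prodCocone c₁ c₂).IsColimit

/-- `C` has sifted colimits: all colimits of small diagrams weighted by sifted weights. -/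
def HasSiftedColimits (C : Type v) [Category.{w} C] [PosEnriched C] : Prop :=
  ∀ (D : Type u) [Category.{u} D] [PosEnriched D] (W : Dᵒᵖ ⥤ PartOrd.{u}) (G : D ⥤ C)
    [PosFunctor G], IsSifted W → ∃ c : WeightedCocone W G, c.IsColimit

/-- The enriched functor `F` preserves sifted colimits. -/
def PreservesSiftedColimits {C : Type v} [Category.{w} C] [PosEnriched C]
    {C' : Type v'} [Category.{w'} C'] [PosEnriched C'] (F : C ⥤ C') [PosFunctor F] : Prop :=
  ∀ (D : Type u) [Category.{u} D] [PosEnriched D] (W : Dᵒᵖ ⥤ PartOrd.{u}) (G : D ⥤ C)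
    [PosFunctor G], IsSifted W → ∀ c : WeightedCocone W G, c.IsColimit → (c.map F).IsColimit

end Sifted

/-! ## Free completions under sifted colimits -/

/-- The enriched functor `J : A ⥤ B` exhibits `B` as the free completion of `A` under
(`u`-small) sifted colimits. Test categories `L` have objects in `Type vL` and morphisms in
`Type wL`. -/
structure IsFreeSiftedCompletion.{u, wL, vL, w, v, w', v'} {A : Type v} [Category.{w} A]
    [PosEnriched A] {B : Type v'} [Category.{w'} B] [PosEnriched B] (J : A ⥤ B) : Prop where
  hasSiftedColimits : HasSiftedColimits.{u} B
  /-- `A` is, via `J`, a full subcategory of `B` with the induced order on hom-sets. -/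
  full {X Y : A} (g : J.obj X ⟶ J.obj Y) : ∃ f : X ⟶ Y, J.map f = g
  map_le_map_iff {X Y : A} (f g : X ⟶ Y) : J.map f ≤ J.map g ↔ f ≤ g
  /-- Every enriched functor on `A` has an extension to `B` preserving sifted colimits. -/
  exists_extension (L : Type vL) [Category.{wL} L] [PosEnriched L]
    (_ : HasSiftedColimits.{u} L) (F : A ⥤ L) [PosFunctor F] :
    ∃ (E : B ⥤ L) (_ : PosFunctor E), PreservesSiftedColimits.{u} E ∧ Nonempty (J ⋙ E ≅ F)
  /-- The extension is unique up to natural isomorphism. -/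
  extension_unique (L : Type vL) [Category.{wL} L] [PosEnriched L]
    (_ : HasSiftedColimits.{u} L) (E E' : B ⥤ L) [PosFunctor E] [PosFunctor E']
    (_ : PreservesSiftedColimits.{u} E) (_ : PreservesSiftedColimits.{u} E') :
    Nonempty (J ⋙ E ≅ J ⋙ E') → Nonempty (E ≅ E')
  /-- Restriction along `J` is fully faithful in the enriched sense on functors preserving
  sifted colimits: it is surjective on natural transformations and reflects their (pointwise)
  order. Together with the existence of extensions, restriction is therefore an equivalence
  from the category of functors `B ⥤ L` preserving sifted colimits to that of functors `A ⥤ L`. -/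
  exists_lift (L : Type vL) [Category.{wL} L] [PosEnriched L]
    (_ : HasSiftedColimits.{u} L) (E E' : B ⥤ L) [PosFunctor E] [PosFunctor E']
    (_ : PreservesSiftedColimits.{u} E) (_ : PreservesSiftedColimits.{u} E')
    (α : J ⋙ E ⟶ J ⋙ E') : ∃ β : E ⟶ E', ∀ X : A, β.app (J.obj X) = α.app X
  le_of_restrict_le (L : Type vL) [Category.{wL} L] [PosEnriched L]
    (_ : HasSiftedColimits.{u} L) (E E' : B ⥤ L) [PosFunctor E] [PosFunctor E']
    (_ : PreservesSiftedColimits.{u} E) (_ : PreservesSiftedColimits.{u} E')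
    (β β' : E ⟶ E') :
    (∀ X : A, β.app (J.obj X) ≤ β'.app (J.obj X)) → ∀ Y : B, β.app Y ≤ β'.app Y

/-! ## Closure under reflexive coinserters, filtered colimits and split coequalizers -/

section Closure

universe u w v

variable {C : Type v} [Category.{w} C] [PosEnriched C]

/-- `f` is a coinserter of the pair `u₀, u₁`: it is universal with respect to
`u₀ ≫ f ≤ u₁ ≫ f`. -/
structure IsCoinserter {U X Y : C} (u₀ u₁ : U ⟶ X) (f : X ⟶ Y) : Prop where
  le : u₀ ≫ f ≤ u₁ ≫ f
  exists_desc {Z : C} (h : X ⟶ Z) : u₀ ≫ h ≤ u₁ ≫ h → ∃ g : Y ⟶ Z, f ≫ g = h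
  le_of_comp_le {Z : C} (g g' : Y ⟶ Z) : f ≫ g ≤ f ≫ g' → g ≤ g'

/-- A reflexive coinserter: a coinserter of a pair of split epimorphisms with a joint
splitting. -/
def IsReflexiveCoinserter {U X Y : C} (u₀ u₁ : U ⟶ X) (f : X ⟶ Y) : Prop :=
  (∃ d : X ⟶ U, d ≫ u₀ = 𝟙 X ∧ d ≫ u₁ = 𝟙 X) ∧ IsCoinserter u₀ u₁ f

/-- The class `Q` of objects is closed in `C` under reflexive coinserters. -/
def ClosedUnderReflexiveCoinserters (Q : ObjectProperty C) : Prop :=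
  ∀ {U X Y : C} (u₀ u₁ : U ⟶ X) (f : X ⟶ Y), IsReflexiveCoinserter u₀ u₁ f → Q U → Q X → Q Y

/-- The class `Q` of objects is closed in `C` under filtered colimits, i.e. conical colimits
(those with weight constantly `1`) of diagrams whose domain is a small enriched category with
filtered underlying category. -/
def ClosedUnderFilteredColimits (Q : ObjectProperty C) : Prop :=
  ∀ (D : Type u) [Category.{u} D] [PosEnriched D] [IsFiltered D] (G : D ⥤ C) [PosFunctor G]
    (c : WeightedCocone (unitDiagram Dᵒᵖ) G), c.IsColimit → (∀ d, Q (G.obj d)) → Q c.pt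

/-- The class `Q` of objects is closed in `C` under split coequalizers. -/
def ClosedUnderSplitCoequalizers (Q : ObjectProperty C) : Prop :=
  ∀ {X Y Z : C} (f g : X ⟶ Y) (e : Y ⟶ Z), Nonempty (IsSplitCoequalizer f g e) →
    Q X → Q Y → Q Z

/-- `C` is the closure of `P` under reflexive coinserters, filtered colimits and split
coequalizers: the only class of objects of `C` which contains `P` and is closed under them is
the class of all objects. -/
def IsClosureOf (P : ObjectProperty C) : Prop :=
  ∀ Q : ObjectProperty C, P ≤ Q → ClosedUnderReflexiveCoinserters Q →
    ClosedUnderFilteredColimits.{u} Q → ClosedUnderSplitCoequalizers Q → ∀ X : C, Q X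

end Closure

/-! ## Varieties of ordered algebras -/

section Varieties

universe u

/-- An ordered algebra for the finitary signature `S` (`S n` is the set of `n`-ary operation
symbols): a poset with monotone operations. -/
structure OrderedAlgebra (S : ℕ → Type u) where
  carrier : Type u
  [order : PartialOrder carrier]
  op {n : ℕ} (σ : S n) : (Fin n → carrier) → carrier
  op_mono {n : ℕ} (σ : S n) : Monotone (op σ)

attribute [instance] OrderedAlgebra.order

instance (S : ℕ → Type u) : CoeSort (OrderedAlgebra S) (Type u) := ⟨OrderedAlgebra.carrier⟩

variable {S : ℕ → Type u}

/-- Monotone homomorphisms of ordered algebras. -/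
@[ext]
structure OrderedAlgebra.Hom (A B : OrderedAlgebra S) where
  toFun : A → B
  monotone : Monotone toFun
  map_op {n : ℕ} (σ : S n) (a : Fin n → A) : toFun (A.op σ a) = B.op σ (fun i => toFun (a i))

instance : Category (OrderedAlgebra S) where
  Hom A B := OrderedAlgebra.Hom A B
  id A := ⟨id, monotone_id, fun _ _ => rfl⟩
  comp f g := ⟨g.toFun ∘ f.toFun, g.monotone.comp f.monotone, fun σ a => by
    simp [f.map_op, g.map_op]⟩

/-- Ordered algebras form an enriched category with the pointwise order on homomorphisms. -/
instance : PosEnriched (OrderedAlgebra S) where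
  homOrder A B := PartialOrder.lift (fun f : OrderedAlgebra.Hom A B => f.toFun)
    (fun _ _ h => OrderedAlgebra.Hom.ext h)
  comp_le_comp {_ _ _ _ f' g _} h h' :=
    fun x => (OrderedAlgebra.Hom.monotone g (h x)).trans (h' (OrderedAlgebra.Hom.toFun f' x))

/-- Terms over the signature `S` in the variables `x₀, x₁, x₂, …`. -/
inductive OrderedTerm (S : ℕ → Type u) : Type u where
  | var (i : ℕ) : OrderedTerm S
  | op {n : ℕ} (σ : S n) (args : Fin n → OrderedTerm S) : OrderedTerm S

/-- The value of a term in an algebra under an interpretation of the variables. -/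
def OrderedTerm.eval (A : OrderedAlgebra S) (a : ℕ → A) : OrderedTerm S → A
  | .var i => a i
  | .op σ args => A.op σ (fun i => (args i).eval A a)

/-- The class of all ordered algebras satisfying the set `E` of inequations; a pair `(s, t)` in
`E` stands for the inequation `s ≤ t`. -/
def satisfies (E : Set (OrderedTerm S × OrderedTerm S)) : ObjectProperty (OrderedAlgebra S) :=
  fun A => ∀ e ∈ E, ∀ a : ℕ → A, e.1.eval A a ≤ e.2.eval A a

/-- The variety of ordered algebras specified by the set `E` of inequations: a full subcategory
of the category of ordered `S`-algebras. -/
abbrev Variety (E : Set (OrderedTerm S × OrderedTerm S)) : Type (u + 1) :=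
  (satisfies E).FullSubcategory

/-- The algebra `A` of a variety is free on the discrete poset `T` with unit `η : T → A`:
for every algebra `B` of the variety, composition with `η` is an isomorphism of posets from the
homomorphisms `A ⟶ B` to the maps `T → B` (all maps out of a discrete poset are monotone). -/
structure IsFreeOnDiscrete {E : Set (OrderedTerm S × OrderedTerm S)} (A : Variety E)
    (T : Type) (η : T → A.obj) : Prop where
  exists_ext (B : Variety E) (b : T → B.obj) :
    ∃ h : A ⟶ B, ∀ t, OrderedAlgebra.Hom.toFun h.hom (η t) = b t
  le_of_unit_le {B : Variety E} (h h' : A ⟶ B) :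
    (∀ t, OrderedAlgebra.Hom.toFun h.hom (η t) ≤ OrderedAlgebra.Hom.toFun h'.hom (η t)) → h ≤ h'

/-- The free algebras of a variety on finite discrete posets. -/
def finiteDiscreteFree (E : Set (OrderedTerm S × OrderedTerm S)) : ObjectProperty (Variety E) :=
  fun A => ∃ (n : ℕ) (η : Fin n → A.obj), IsFreeOnDiscrete A (Fin n) η

end Varieties

end PosCat

universe u wL vL

/-!
Two facts carry the proof: homomorphisms out of finitely generated free algebras commute with
sifted colimits, and every algebra is a sifted colimit of finitely generated free algebras.

A sifted colimit of algebras is computed on underlying posets: an operation of arity `n` is defined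
on the `n`-th power of the colimit, and that power is again a colimit (`IsSifted.pow`), so the
operations, and the inequations between terms, pass from the diagram to the colimit
(`IsSifted.exists_colimit`). Hence `K(F n, -)`, the `n`-th power of the forgetful functor, preserves
sifted colimits (`IsSifted.exists_factor`, `IsSifted.exists_desc_hom`). Conversely, every algebra
`X` is the colimit of the free algebras `F n` weighted by `n ↦ K(F n, X)`
(`canonicalCocone_isColimit`), and this weight is sifted because it turns the coproducts
`F (n + m)` into products (`isSifted_of_coproducts`, `isSifted_nerve`).

These facts give the universal property. A functor on free algebras is extended to `X` by its
colimit weighted by `K(F -, X)`; the extension preserves sifted colimits since colimits commute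
with colimits and the weights depend on `X` through functors that preserve sifted colimits
(`preservesSiftedColimits_extension`). Functors that preserve sifted colimits preserve the canonical
presentation of `X`, so transformations between them, and inequalities between such transformations,
are determined by the free algebras (`exists_lift_natTrans`, `natTrans_le_of_restrict_le`).

For the closure statement, the free algebra on any set is the filtered colimit of the free algebras
on its finite subsets, and every algebra `X` is a reflexive coinserter of free algebras
(`isReflexiveCoinserter_counit`).

Hom-posets of a test category may live in a larger universe than the weights;
`WeightedCocone.IsColimit.exists_desc_of_large` extends the universal property of colimits of small
posets to them.
-/

namespace PosCat

/-! ### Weighted colimits in a category enriched over posets -/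

section WeightedColimits

universe w v w' v' w'' v''

instance {A : Type v} [Category.{w} A] [PosEnriched A] {B : Type v'} [Category.{w'} B]
    [PosEnriched B] {C : Type v''} [Category.{w''} C] [PosEnriched C] (F : A ⥤ B) (G : B ⥤ C)
    [PosFunctor F] [PosFunctor G] : PosFunctor (F ⋙ G) where
  map_le h := PosFunctor.map_le (F := G) (PosFunctor.map_le (F := F) h)

instance {C : Type v} [Category.{w} C] [PosEnriched C] (P : ObjectProperty C) :
    PosFunctor P.ι where
  map_le h := h

variable {C : Type v} [Category.{w} C] [PosEnriched C]

theorem comp_le_comp_left {X Y Z : C} (f : X ⟶ Y) {g g' : Y ⟶ Z} (h : g ≤ g') :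
    f ≫ g ≤ f ≫ g' :=
  PosEnriched.comp_le_comp le_rfl h

theorem comp_le_comp_right {X Y Z : C} {f f' : X ⟶ Y} (h : f ≤ f') (g : Y ⟶ Z) :
    f ≫ g ≤ f' ≫ g :=
  PosEnriched.comp_le_comp h le_rfl

variable {D : Type u} [Category.{u} D] {W : Dᵒᵖ ⥤ PartOrd.{u}} {G G' : D ⥤ C}

theorem WeightedCocone.IsColimit.hom_ext {c : WeightedCocone W G} (hc : c.IsColimit) {X : C}
    {g g' : c.pt ⟶ X} (h : ∀ d x, c.leg d x ≫ g = c.leg d x ≫ g') : g = g' :=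
  le_antisymm (hc.le_of_legs _ _ fun d x => (h d x).le) (hc.le_of_legs _ _ fun d x => (h d x).ge)

theorem WeightedCocone.IsColimit.exists_desc_of {c : WeightedCocone W G} (hc : c.IsColimit)
    {X : C} (φ : ∀ d, W.obj (.op d) → (G.obj d ⟶ X)) (mono : ∀ d, Monotone (φ d))
    (nat : ∀ {d d' : D} (f : d ⟶ d') (x : W.obj (.op d')), φ d (W.map f.op x) = G.map f ≫ φ d' x) :
    ∃ g : c.pt ⟶ X, ∀ d x, c.leg d x ≫ g = φ d x :=
  hc.exists_desc ⟨X, φ, mono, nat⟩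

/-- Being a colimit is invariant under isomorphisms of diagrams and of cocones. -/
theorem WeightedCocone.IsColimit.of_iso {c : WeightedCocone W G} (hc : c.IsColimit)
    {c' : WeightedCocone W G'} (φ : G ≅ G') (e : c.pt ≅ c'.pt)
    (h : ∀ d x, c.leg d x ≫ e.hom = φ.hom.app d ≫ c'.leg d x) : c'.IsColimit := by
  have h' : ∀ d x, c'.leg d x ≫ e.inv = φ.inv.app d ≫ c.leg d x := fun d x => by
    rw [Iso.comp_inv_eq, Category.assoc, h, Iso.inv_hom_id_app_assoc]
  constructor
  · intro s
    obtain ⟨g, hg⟩ := hc.exists_desc_of (fun d x => φ.hom.app d ≫ s.leg d x)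
      (fun d _ _ h => comp_le_comp_left _ (s.leg_mono d h))
      (fun f x => by simp [s.naturality f x])
    refine ⟨e.inv ≫ g, fun d x => ?_⟩
    rw [← Category.assoc, h', Category.assoc, hg, φ.inv_hom_id_app_assoc]
  · intro X g g' hg
    have : e.hom ≫ g ≤ e.hom ≫ g' := hc.le_of_legs _ _ fun d x => by
      rw [← Category.assoc, ← Category.assoc, h, Category.assoc, Category.assoc]
      exact comp_le_comp_left _ (hg d x)
    simpa using comp_le_comp_left e.inv this

theorem WeightedCocone.IsColimit.exists_iso {c c' : WeightedCocone W G} (hc : c.IsColimit)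
    (hc' : c'.IsColimit) : ∃ e : c.pt ≅ c'.pt, ∀ d x, c.leg d x ≫ e.hom = c'.leg d x := by
  obtain ⟨f, hf⟩ := hc.exists_desc c'
  obtain ⟨g, hg⟩ := hc'.exists_desc c
  exact ⟨⟨f, g, hc.hom_ext fun d x => by rw [← Category.assoc, hf, hg, Category.comp_id],
    hc'.hom_ext fun d x => by rw [← Category.assoc, hg, hf, Category.comp_id]⟩, hf⟩

end WeightedColimits

/-! ### Weighted colimits of posets -/

section Posets

universe w

variable {D : Type u} [Category.{u} D] {W : Dᵒᵖ ⥤ PartOrd.{u}} {G : D ⥤ PartOrd.{u}}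

theorem WeightedCocone.leg_map_apply (c : WeightedCocone W G) {d d' : D} (f : d ⟶ d')
    (x : W.obj (.op d')) (a : G.obj d) : c.leg d (W.map f.op x) a = c.leg d' x (G.map f a) := by
  rw [c.naturality f x, PartOrd.comp_apply]

/-- The elements of `∑ d, W d × G d`, preordered by the inequalities that hold in every
weighted cocone. -/
structure ColimitElem (W : Dᵒᵖ ⥤ PartOrd.{u}) (G : D ⥤ PartOrd.{u}) where
  d : D
  x : W.obj (.op d)
  a : G.obj d

instance : Preorder (ColimitElem W G) where
  le p q := ∀ s : WeightedCocone W G, s.leg p.d p.x p.a ≤ s.leg q.d q.x q.a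
  le_refl _ _ := le_rfl
  le_trans _ _ _ h h' s := (h s).trans (h' s)

variable (W G) in
/-- The weighted colimit of a diagram of posets: the poset reflection of `ColimitElem W G`. -/
def posColimit : WeightedCocone W G where
  pt := PartOrd.of (Antisymmetrization (ColimitElem W G) (· ≤ ·))
  leg d x := PartOrd.ofHom
    ⟨fun a => toAntisymmetrization (· ≤ ·) ⟨d, x, a⟩, fun _ _ h s => (s.leg d x).hom.monotone h⟩
  leg_mono d _ _ h a s := s.leg_mono d h a
  naturality {d d'} f x := by
    ext a
    exact Quotient.sound
      ⟨fun s => (s.leg_map_apply f x a).le, fun s => (s.leg_map_apply f x a).ge⟩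

theorem posColimit_isColimit : (posColimit W G).IsColimit where
  exists_desc s := by
    refine ⟨PartOrd.ofHom ⟨Quotient.lift (fun p => s.leg p.d p.x p.a) fun p q h =>
      le_antisymm (h.1 s) (h.2 s), ?_⟩, fun d x => rfl⟩
    rintro ⟨p⟩ ⟨q⟩ h
    exact h s
  le_of_legs g g' h := by
    rintro ⟨p⟩
    exact h p.d p.x p.a

namespace WeightedCocone.IsColimit

variable {c : WeightedCocone W G} (hc : c.IsColimit)
include hc

/-- The legs of a weighted colimit of posets are jointly surjective. -/
theorem exists_rep (p : c.pt) : ∃ d x a, c.leg d x a = p := by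
  obtain ⟨e, he⟩ := posColimit_isColimit.exists_iso hc
  obtain ⟨q, hq⟩ : ∃ q : ColimitElem W G, toAntisymmetrization (· ≤ ·) q = e.inv p :=
    Quotient.exists_rep _
  refine ⟨q.d, q.x, q.a, ?_⟩
  rw [← he, PartOrd.comp_apply]
  change e.hom (toAntisymmetrization (· ≤ ·) q) = p
  rw [hq]
  exact PartOrd.hom_inv_apply e p

/-- A weighted colimit in the category of `u`-small posets is universal among all posets, since
the image of a weighted cocone is `u`-small. -/
theorem exists_desc_of_large {Y : Type w} [PartialOrder Y]
    (φ : ∀ d, W.obj (.op d) → G.obj d → Y) (mono_left : ∀ d a, Monotone fun x => φ d x a)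
    (mono_right : ∀ d x, Monotone (φ d x))
    (nat : ∀ {d d' : D} (f : d ⟶ d') (x : W.obj (.op d')) (a : G.obj d),
      φ d (W.map f.op x) a = φ d' x (G.map f a)) :
    ∃ g : c.pt → Y, Monotone g ∧ ∀ d x a, g (c.leg d x a) = φ d x a := by
  let R : Set Y := Set.range fun p : ColimitElem W G => φ p.d p.x p.a
  have : Small.{u} (ColimitElem W G) := by
    refine small_of_injective (β := Σ d, W.obj (.op d) × G.obj d)
      (f := fun p => ⟨p.d, p.x, p.a⟩) ?_
    rintro ⟨d, x, a⟩ ⟨d', x', a'⟩ h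
    cases h
    rfl
  have : Small.{u} R := small_range _
  obtain ⟨g, hg⟩ := hc.exists_desc_of (X := PartOrd.of (Shrink.{u} R))
    (fun d x => PartOrd.ofHom ⟨fun a => orderIsoShrink R ⟨φ d x a, ⟨d, x, a⟩, rfl⟩,
      fun _ _ h => (orderIsoShrink R).monotone (mono_right d x h)⟩)
    (fun d _ _ h a => (orderIsoShrink R).monotone (mono_left d a h))
    (fun f x => PartOrd.ext fun a =>
      congrArg (orderIsoShrink R) (Subtype.ext (nat f x a) : (_ : R) = _))
  refine ⟨fun p => ((orderIsoShrink R).symm (g p)).1,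
    fun _ _ h => (orderIsoShrink R).symm.monotone (g.hom.monotone h), fun d x a => ?_⟩
  have : g (c.leg d x a) = orderIsoShrink R ⟨φ d x a, ⟨d, x, a⟩, rfl⟩ :=
    congrArg (fun k : G.obj d ⟶ PartOrd.of (Shrink.{u} R) => k a) (hg d x)
  simp only [this, OrderIso.symm_apply_apply]

end WeightedCocone.IsColimit

end Posets

/-! ### Finite powers of sifted colimits -/

section Powers

variable {D : Type u} [Category.{u} D] {W : Dᵒᵖ ⥤ PartOrd.{u}} {G : D ⥤ PartOrd.{u}}

/-- The pointwise `n`-th power of a diagram of posets. -/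
def powDiagram (G : D ⥤ PartOrd.{u}) (n : ℕ) : D ⥤ PartOrd.{u} where
  obj d := PartOrd.of (Fin n → G.obj d)
  map f := PartOrd.ofHom ⟨fun a i => G.map f (a i), fun _ _ h i => (G.map f).hom.monotone (h i)⟩

/-- The `n`-th power of a weighted cocone of posets. -/
def powCocone (c : WeightedCocone W G) (n : ℕ) : WeightedCocone W (powDiagram G n) where
  pt := PartOrd.of (Fin n → c.pt)
  leg d x := PartOrd.ofHom
    ⟨fun a i => c.leg d x (a i), fun _ _ h i => (c.leg d x).hom.monotone (h i)⟩
  leg_mono d _ _ h a i := c.leg_mono d h (a i)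
  naturality f x := PartOrd.ext fun a => funext fun i => c.leg_map_apply f x (a i)

variable [PosEnriched D]

instance [PosFunctor G] (n : ℕ) : PosFunctor (powDiagram G n) where
  map_le {_ _ _ _} h a i := PosFunctor.map_le (F := G) h (a i)

/-- Sifted colimits of posets commute with finite powers. -/
theorem IsSifted.pow (hW : IsSifted W) [PosFunctor G] {c : WeightedCocone W G}
    (hc : c.IsColimit) (n : ℕ) : (powCocone c n).IsColimit := by
  induction n with
  | zero =>
    refine hW.unit.of_iso
      (NatIso.ofComponents (fun d => PartOrd.Iso.mk (OrderIso.ofUnique PUnit (Fin 0 → G.obj d))) ?_)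
      (PartOrd.Iso.mk (OrderIso.ofUnique PUnit (Fin 0 → c.pt))) ?_
    · intro d d' f
      ext a
      exact Subsingleton.elim (α := Fin 0 → G.obj d') _ _
    · intro d x
      ext a
      exact Subsingleton.elim (α := Fin 0 → c.pt) _ _
  | succ n ih =>
    refine (hW.prod _ _ _ _ hc ih).of_iso
      (NatIso.ofComponents
        (fun d => PartOrd.Iso.mk (Fin.consOrderIso fun _ : Fin (n + 1) => G.obj d)) ?_)
      (PartOrd.Iso.mk (Fin.consOrderIso fun _ : Fin (n + 1) => c.pt)) ?_
    · intro d d' f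
      ext a
      refine funext fun i => ?_
      induction i using Fin.cases <;> rfl
    · intro d x
      ext a
      refine funext fun i => ?_
      induction i using Fin.cases <;> rfl

end Powers

/-! ### Weights that turn finite coproducts into products -/

section SiftedWeights

variable {D : Type u} [Category.{u} D] [PosEnriched D] (W : Dᵒᵖ ⥤ PartOrd.{u})

/-- A weight on a category with finite coproducts which turns them into products is sifted. For
binary products, a cocone over `G₁ × G₂` is curried: its value at `(a₁, a₂)`, with `aᵢ` in
`Gᵢ dᵢ`, is obtained by moving both elements to a coproduct of `d₁` and `d₂`. -/
theorem isSifted_of_coproducts [PosFunctor W]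
    (zero : ∃ (o : D) (x₀ : W.obj (.op o)), ∀ d (x : W.obj (.op d)), ∃ f : o ⟶ d, W.map f.op x = x₀)
    (coprod : ∀ d d' : D, ∃ (e : D) (i : d ⟶ e) (j : d' ⟶ e),
      (∀ {z} (f : d ⟶ z) (f' : d' ⟶ z), ∃ h : e ⟶ z, i ≫ h = f ∧ j ≫ h = f') ∧
      (∀ x x', ∃ y, W.map i.op y = x ∧ W.map j.op y = x') ∧
      ∀ y y', W.map i.op y ≤ W.map i.op y' → W.map j.op y ≤ W.map j.op y' → y ≤ y') :
    IsSifted W where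
  posFunctor := inferInstance
  unit := by
    obtain ⟨o, x₀, h₀⟩ := zero
    constructor
    · intro s
      refine ⟨s.leg o x₀, fun d x => ?_⟩
      obtain ⟨f, hf⟩ := h₀ d x
      rw [← hf, s.naturality f x]
      rfl
    · intro X g g' h
      exact h o x₀
  prod G₁ G₂ _ _ c₁ c₂ h₁ h₂ := by
    choose e i j hcop hpair hle using coprod
    choose pair pair_i pair_j using hpair
    have map_comp : ∀ {a b z : D} (f : a ⟶ b) (g : b ⟶ z) (y : W.obj (.op z)),
        W.map f.op (W.map g.op y) = W.map (f ≫ g).op y := fun f g y => by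
      rw [op_comp, W.map_comp, PartOrd.comp_apply]
    have hext : ∀ d d' y y', W.map (i d d').op y = W.map (i d d').op y' →
        W.map (j d d').op y = W.map (j d d').op y' → y = y' := fun d d' y y' hi hj =>
      le_antisymm (hle _ _ _ _ hi.le hj.le) (hle _ _ _ _ hi.ge hj.ge)
    constructor
    · intro s
      -- The value of the cocone at a pair of elements over a coproduct.
      let θ (d₁ : D) (x₁ : W.obj (.op d₁)) (a₁ : G₁.obj d₁) (d₂ : D) (x₂ : W.obj (.op d₂))
          (a₂ : G₂.obj d₂) : s.pt :=
        s.leg (e d₁ d₂) (pair d₁ d₂ x₁ x₂) (G₁.map (i d₁ d₂) a₁, G₂.map (j d₁ d₂) a₂)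
      have θ_eq : ∀ {d₁ d₂ z} (f₁ : d₁ ⟶ z) (f₂ : d₂ ⟶ z) (y : W.obj (.op z)) a₁ a₂,
          θ d₁ (W.map f₁.op y) a₁ d₂ (W.map f₂.op y) a₂ =
            s.leg z y (G₁.map f₁ a₁, G₂.map f₂ a₂) := by
        intro d₁ d₂ z f₁ f₂ y a₁ a₂
        obtain ⟨h, hi, hj⟩ := hcop d₁ d₂ f₁ f₂
        have : pair d₁ d₂ (W.map f₁.op y) (W.map f₂.op y) = W.map h.op y := by
          apply hext
          · rw [pair_i, map_comp, hi]
          · rw [pair_j, map_comp, hj]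
        have h1 : G₁.map f₁ a₁ = G₁.map h (G₁.map (i d₁ d₂) a₁) := by
          rw [← PartOrd.comp_apply, ← G₁.map_comp, hi]
        have h2 : G₂.map f₂ a₂ = G₂.map h (G₂.map (j d₁ d₂) a₂) := by
          rw [← PartOrd.comp_apply, ← G₂.map_comp, hj]
        simp only [θ]
        rw [this, h1, h2]
        exact s.leg_map_apply h y (_, _)
      have θ_mono_left : ∀ {d₁ d₂ x₁ x₁' a₁ a₁' x₂ a₂}, x₁ ≤ x₁' → a₁ ≤ a₁' →
          θ d₁ x₁ a₁ d₂ x₂ a₂ ≤ θ d₁ x₁' a₁' d₂ x₂ a₂ := by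
        intro d₁ d₂ x₁ x₁' a₁ a₁' x₂ a₂ hx ha
        refine (s.leg_mono _ (hle _ _ _ _ ?_ ?_) _).trans ((s.leg _ _).hom.monotone
          ⟨(G₁.map _).hom.monotone ha, le_rfl⟩)
        · rw [pair_i, pair_i]; exact hx
        · rw [pair_j, pair_j]
      have θ_mono_right : ∀ {d₁ d₂ x₁ a₁ x₂ x₂' a₂ a₂'}, x₂ ≤ x₂' → a₂ ≤ a₂' →
          θ d₁ x₁ a₁ d₂ x₂ a₂ ≤ θ d₁ x₁ a₁ d₂ x₂' a₂' := by
        intro d₁ d₂ x₁ a₁ x₂ x₂' a₂ a₂' hx ha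
        refine (s.leg_mono _ (hle _ _ _ _ ?_ ?_) _).trans ((s.leg _ _).hom.monotone
          ⟨le_rfl, (G₂.map _).hom.monotone ha⟩)
        · rw [pair_i, pair_i]
        · rw [pair_j, pair_j]; exact hx
      have θ_nat_left : ∀ {d₁ d₁' d₂} (f : d₁ ⟶ d₁') (x₁ : W.obj (.op d₁')) a₁ x₂ a₂,
          θ d₁ (W.map f.op x₁) a₁ d₂ x₂ a₂ = θ d₁' x₁ (G₁.map f a₁) d₂ x₂ a₂ := by
        intro d₁ d₁' d₂ f x₁ a₁ x₂ a₂
        have := θ_eq (f ≫ i d₁' d₂) (j d₁' d₂) (pair d₁' d₂ x₁ x₂) a₁ a₂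
        rwa [← map_comp, pair_i, pair_j, G₁.map_comp, PartOrd.comp_apply] at this
      have θ_nat_right : ∀ {d₁ d₂ d₂'} (f : d₂ ⟶ d₂') x₁ a₁ (x₂ : W.obj (.op d₂')) a₂,
          θ d₁ x₁ a₁ d₂ (W.map f.op x₂) a₂ = θ d₁ x₁ a₁ d₂' x₂ (G₂.map f a₂) := by
        intro d₁ d₂ d₂' f x₁ a₁ x₂ a₂
        have := θ_eq (i d₁ d₂') (f ≫ j d₁ d₂') (pair d₁ d₂' x₁ x₂) a₁ a₂
        rwa [← map_comp, pair_i, pair_j, G₂.map_comp, PartOrd.comp_apply] at this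
      have key := fun d₁ x₁ a₁ => h₂.exists_desc_of_large (θ d₁ x₁ a₁)
        (fun _ _ _ _ h => θ_mono_right h le_rfl) (fun _ _ _ _ h => θ_mono_right le_rfl h)
        (fun f x a => θ_nat_right f x₁ a₁ x a)
      choose ψ ψ_mono hψ using key
      obtain ⟨g, g_mono, hg⟩ := h₁.exists_desc_of_large (Y := c₂.pt → s.pt) ψ
        (fun d a x x' h p => by
          obtain ⟨d₂, x₂, a₂, rfl⟩ := h₂.exists_rep p
          simp only [hψ]
          exact θ_mono_left h le_rfl)
        (fun d x a a' h p => by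
          obtain ⟨d₂, x₂, a₂, rfl⟩ := h₂.exists_rep p
          simp only [hψ]
          exact θ_mono_left le_rfl h)
        (fun f x a => funext fun p => by
          obtain ⟨d₂, x₂, a₂, rfl⟩ := h₂.exists_rep p
          simp only [hψ]
          exact θ_nat_left f x a x₂ a₂)
      have g_mono_right : ∀ p, Monotone (g p) := fun p => by
        obtain ⟨d, x, a, rfl⟩ := h₁.exists_rep p
        rw [hg]
        exact ψ_mono d x a
      refine ⟨PartOrd.ofHom ⟨fun p => g p.1 p.2,
        fun p q h => (g_mono h.1 p.2).trans (g_mono_right q.1 h.2)⟩, fun d x => ?_⟩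
      ext a
      change g (c₁.leg d x a.1) (c₂.leg d x a.2) = s.leg d x a
      have hx : W.map (𝟙 d).op x = x := by rw [op_id, W.map_id, PartOrd.id_apply]
      have := θ_eq (𝟙 d) (𝟙 d) x a.1 a.2
      rw [hx, G₁.map_id, G₂.map_id] at this
      rw [hg, hψ]
      exact this
    · intro X g g' h p
      obtain ⟨d₁, x₁, a₁, hp₁⟩ := h₁.exists_rep p.1
      obtain ⟨d₂, x₂, a₂, hp₂⟩ := h₂.exists_rep p.2
      have hp : (prodCocone c₁ c₂).leg (e d₁ d₂) (pair d₁ d₂ x₁ x₂)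
          (G₁.map (i d₁ d₂) a₁, G₂.map (j d₁ d₂) a₂) = p := by
        refine Prod.ext ?_ ?_
        · refine Eq.trans ?_ hp₁
          refine (c₁.leg_map_apply (i d₁ d₂) (pair d₁ d₂ x₁ x₂) a₁).symm.trans ?_
          rw [pair_i]
        · refine Eq.trans ?_ hp₂
          refine (c₂.leg_map_apply (j d₁ d₂) (pair d₁ d₂ x₁ x₂) a₂).symm.trans ?_
          rw [pair_j]
      rw [← hp]
      exact h (e d₁ d₂) (pair d₁ d₂ x₁ x₂) (G₁.map (i d₁ d₂) a₁, G₂.map (j d₁ d₂) a₂)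

end SiftedWeights

/-! ### Free algebras of a variety -/

section FreeAlgebras

variable {S : ℕ → Type u} {E : Set (OrderedTerm S × OrderedTerm S)}

/-- The map underlying a homomorphism between algebras of a variety. -/
abbrev Variety.app {A B : Variety E} (f : A ⟶ B) : A.obj → B.obj := OrderedAlgebra.Hom.toFun f.hom

theorem Variety.app_op {A B : Variety E} (f : A ⟶ B) {n : ℕ} (σ : S n) (a : Fin n → A.obj) :
    app f (A.obj.op σ a) = B.obj.op σ fun i => app f (a i) :=
  OrderedAlgebra.Hom.map_op f.hom σ a

theorem Variety.app_mono {A B : Variety E} (f : A ⟶ B) : Monotone (app f) :=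
  OrderedAlgebra.Hom.monotone f.hom

theorem Variety.hom_ext {A B : Variety E} {f g : A ⟶ B} (h : ∀ a, app f a = app g a) : f = g :=
  le_antisymm (fun a => (h a).le) fun a => (h a).ge

/-- A homomorphism of a variety, from a map with its properties. -/
def Variety.mkHom {A B : Variety E} (f : A.obj → B.obj) (hf : Monotone f)
    (hop : ∀ {n : ℕ} (σ : S n) (a : Fin n → A.obj),
      f (A.obj.op σ a) = B.obj.op σ fun i => f (a i)) :
    A ⟶ B :=
  ObjectProperty.homMk (OrderedAlgebra.Hom.mk f hf hop)

/-- Terms over the signature `S` in variables from an arbitrary set `T`. -/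
inductive FreeTerm (S : ℕ → Type u) (T : Type u) : Type u where
  | var (t : T) : FreeTerm S T
  | op {n : ℕ} (σ : S n) (args : Fin n → FreeTerm S T) : FreeTerm S T

variable {T : Type u}

/-- The value of a term in an algebra under an interpretation of the variables. -/
def FreeTerm.eval (A : OrderedAlgebra S) (a : T → A) : FreeTerm S T → A
  | .var t => a t
  | .op σ args => A.op σ fun i => (args i).eval A a

/-- Substitution of terms in variables from `T` for the variables `x₀, x₁, x₂, …`. -/
def OrderedTerm.subst (v : ℕ → FreeTerm S T) : OrderedTerm S → FreeTerm S T
  | .var i => v i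
  | .op σ args => .op σ fun i => (args i).subst v

theorem OrderedTerm.eval_subst (v : ℕ → FreeTerm S T) (A : OrderedAlgebra S) (a : T → A)
    (t : OrderedTerm S) : (t.subst v).eval A a = t.eval A fun i => (v i).eval A a := by
  induction t with
  | var i => rfl
  | op σ args ih => simp only [OrderedTerm.subst, OrderedTerm.eval, FreeTerm.eval, ih]

/-- Terms are preordered by the inequations that hold in all algebras of the variety. -/
abbrev freeTermPreorder (E : Set (OrderedTerm S × OrderedTerm S)) (T : Type u) :
    Preorder (FreeTerm S T) where
  le s t := ∀ (B : Variety E) (b : T → B.obj), s.eval B.obj b ≤ t.eval B.obj b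
  le_refl _ _ _ := le_rfl
  le_trans _ _ _ h h' B b := (h B b).trans (h' B b)

/-- The underlying poset of the free algebra: terms modulo the equations that hold in the
variety. -/
abbrev FreeCarrier (E : Set (OrderedTerm S × OrderedTerm S)) (T : Type u) : Type u :=
  letI := freeTermPreorder E T
  Antisymmetrization (FreeTerm S T) (· ≤ ·)

/-- The element of the free algebra represented by a term. -/
def FreeCarrier.mk (E : Set (OrderedTerm S × OrderedTerm S)) (t : FreeTerm S T) :
    FreeCarrier E T :=
  letI := freeTermPreorder E T
  toAntisymmetrization (· ≤ ·) t

theorem FreeCarrier.mk_le_mk {s t : FreeTerm S T} : mk E s ≤ mk E t ↔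
    ∀ (B : Variety E) (b : T → B.obj), s.eval B.obj b ≤ t.eval B.obj b :=
  Iff.rfl

/-- A term representing a given element of the free algebra. -/
noncomputable def FreeCarrier.rep (p : FreeCarrier E T) : FreeTerm S T :=
  letI := freeTermPreorder E T
  ofAntisymmetrization (· ≤ ·) p

theorem FreeCarrier.mk_rep (p : FreeCarrier E T) : mk E p.rep = p :=
  letI := freeTermPreorder E T
  toAntisymmetrization_ofAntisymmetrization (· ≤ ·) p

theorem FreeCarrier.mk_op_le {n : ℕ} (σ : S n) {s t : Fin n → FreeTerm S T}
    (h : ∀ i, mk E (s i) ≤ mk E (t i)) : mk E (.op σ s) ≤ mk E (.op σ t) :=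
  mk_le_mk.2 fun B b => B.obj.op_mono σ fun i => mk_le_mk.1 (h i) B b

/-- The ordered algebra of terms modulo the equations that hold in the variety. -/
noncomputable def termAlgebra (E : Set (OrderedTerm S × OrderedTerm S)) (T : Type u) :
    OrderedAlgebra S where
  carrier := FreeCarrier E T
  op σ a := .mk E (.op σ fun i => (a i).rep)
  op_mono σ a b h := FreeCarrier.mk_op_le σ fun i => by
    rw [FreeCarrier.mk_rep, FreeCarrier.mk_rep]
    exact h i

theorem termAlgebra_op_mk {n : ℕ} (σ : S n) (t : Fin n → FreeTerm S T) :
    (termAlgebra E T).op σ (fun i => .mk E (t i)) = .mk E (.op σ t) :=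
  le_antisymm (FreeCarrier.mk_op_le σ fun _ => (FreeCarrier.mk_rep _).le)
    (FreeCarrier.mk_op_le σ fun _ => (FreeCarrier.mk_rep _).ge)

theorem termAlgebra_eval (v : ℕ → FreeTerm S T) (t : OrderedTerm S) :
    t.eval (termAlgebra E T) (fun i => .mk E (v i)) = .mk E (t.subst v) := by
  induction t with
  | var i => rfl
  | op σ args ih =>
    simp only [OrderedTerm.eval, OrderedTerm.subst, ih]
    exact termAlgebra_op_mk σ _

theorem satisfies_termAlgebra : satisfies E (termAlgebra E T) := by
  intro e he a
  have ha : a = fun i => FreeCarrier.mk E (FreeCarrier.rep (a i)) :=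
    funext fun i => (FreeCarrier.mk_rep (a i)).symm
  rw [ha, termAlgebra_eval, termAlgebra_eval]
  refine FreeCarrier.mk_le_mk.2 fun B b => ?_
  rw [OrderedTerm.eval_subst, OrderedTerm.eval_subst]
  exact B.property e he _

/-- The free algebra of the variety on the discrete poset `T`. -/
noncomputable def freeAlgebra (E : Set (OrderedTerm S × OrderedTerm S)) (T : Type u) :
    Variety E :=
  ⟨termAlgebra E T, satisfies_termAlgebra⟩

/-- The generators of the free algebra. -/
def freeUnit (E : Set (OrderedTerm S × OrderedTerm S)) (t : T) : (freeAlgebra E T).obj :=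
  FreeCarrier.mk E (.var t)

/-- The homomorphism from the free algebra with given values on the generators. -/
noncomputable def freeLift {B : Variety E} (b : T → B.obj) : freeAlgebra E T ⟶ B :=
  Variety.mkHom (A := freeAlgebra E T)
    (Quotient.lift (fun t : FreeTerm S T => t.eval B.obj b)
      fun _ _ h => le_antisymm (h.1 B b) (h.2 B b))
    (by
      rintro ⟨s⟩ ⟨t⟩ h
      exact h B b)
    (by
      intro n σ a
      refine congrArg (B.obj.op σ) (funext fun i => ?_)
      conv_rhs => rw [← FreeCarrier.mk_rep (a i)]
      rfl)

@[simp]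
theorem freeLift_unit {B : Variety E} (b : T → B.obj) (t : T) :
    Variety.app (freeLift b) (freeUnit E t) = b t := rfl

theorem free_hom_le {B : Variety E} {f g : freeAlgebra E T ⟶ B}
    (h : ∀ t, Variety.app f (freeUnit E t) ≤ Variety.app g (freeUnit E t)) : f ≤ g := by
  rintro ⟨t⟩
  change Variety.app f (FreeCarrier.mk E t) ≤ Variety.app g (FreeCarrier.mk E t)
  induction t with
  | var t => exact h t
  | op σ args ih =>
    rw [← termAlgebra_op_mk]
    have hf := Variety.app_op f σ fun i => FreeCarrier.mk E (args i)
    have hg := Variety.app_op g σ fun i => FreeCarrier.mk E (args i)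
    exact hf.le.trans ((B.obj.op_mono σ ih).trans hg.ge)

theorem free_hom_ext {B : Variety E} {f g : freeAlgebra E T ⟶ B}
    (h : ∀ t, Variety.app f (freeUnit E t) = Variety.app g (freeUnit E t)) : f = g :=
  le_antisymm (free_hom_le fun t => (h t).le) (free_hom_le fun t => (h t).ge)

theorem freeLift_eta {B : Variety E} (f : freeAlgebra E T ⟶ B) :
    freeLift (fun t => Variety.app f (freeUnit E t)) = f :=
  free_hom_ext fun _ => rfl

theorem freeLift_comp {B C : Variety E} (b : T → B.obj) (f : B ⟶ C) :
    freeLift b ≫ f = freeLift fun t => Variety.app f (b t) :=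
  free_hom_ext fun _ => rfl

theorem freeLift_mono {B : Variety E} : Monotone (freeLift : (T → B.obj) → (freeAlgebra E T ⟶ B)) :=
  fun _ _ h => free_hom_le h

theorem finiteDiscreteFree_freeAlgebra [Finite T] : finiteDiscreteFree E (freeAlgebra E T) := by
  obtain ⟨n, ⟨e⟩⟩ := Finite.exists_equiv_fin T
  refine ⟨n, fun i => freeUnit E (e.symm i), fun B b => ⟨freeLift fun t => b (e t), fun i => ?_⟩,
    fun h h' H => free_hom_le fun t => ?_⟩
  · exact congrArg b (e.apply_symm_apply i)
  · simpa using H (e t)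

end FreeAlgebras

/-! ### Sifted colimits of algebras -/

section SiftedColimits

universe w

variable {S : ℕ → Type u} {E : Set (OrderedTerm S × OrderedTerm S)}

/-- The forgetful functor from a variety to posets. -/
def forgetPos (E : Set (OrderedTerm S × OrderedTerm S)) : Variety E ⥤ PartOrd.{u} where
  obj A := PartOrd.of A.obj
  map f := PartOrd.ofHom ⟨Variety.app f, Variety.app_mono f⟩

instance : PosFunctor (forgetPos E) where
  map_le h := h

/-- The value of a term depends on finitely many variables only. -/
theorem OrderedTerm.exists_eval_congr (t : OrderedTerm S) :
    ∃ N : ℕ, ∀ (A : OrderedAlgebra S) (a a' : ℕ → A), (∀ i ≤ N, a i = a' i) →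
      t.eval A a = t.eval A a' := by
  induction t with
  | var i => exact ⟨i, fun A a a' h => h i le_rfl⟩
  | op σ args ih =>
    choose N hN using ih
    refine ⟨Finset.univ.sup N, fun A a a' h => congrArg (A.op σ) (funext fun i => ?_)⟩
    exact hN i A a a' fun j hj => h j (hj.trans (Finset.le_sup (Finset.mem_univ i)))

variable {D : Type u} [Category.{u} D] [PosEnriched D] {W : Dᵒᵖ ⥤ PartOrd.{u}}
  {G : D ⥤ Variety E} [PosFunctor G]

/-- The colimit of the underlying posets carries the structure of an algebra of the variety,
since the operations of arity `n` are defined on its `n`-th power, which is a colimit of the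
`n`-th powers. -/
theorem IsSifted.exists_colimit (hW : IsSifted W) :
    ∃ c : WeightedCocone W G, c.IsColimit ∧ (c.map (forgetPos E)).IsColimit := by
  let c := posColimit W (G ⋙ forgetPos E)
  have hc : c.IsColimit := posColimit_isColimit
  have hpow := hW.pow hc
  have key : ∀ {n : ℕ} (σ : S n), ∃ o : (Fin n → c.pt) → c.pt, Monotone o ∧
      ∀ d x (a : Fin n → (G.obj d).obj),
        o (fun i => c.leg d x (a i)) = c.leg d x ((G.obj d).obj.op σ a) := fun {n} σ =>
    (hpow n).exists_desc_of_large
      (fun d x a => c.leg d x ((G.obj d).obj.op σ a))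
      (fun d a _ _ h => c.leg_mono d h _)
      (fun d x _ _ h => (c.leg d x).hom.monotone ((G.obj d).obj.op_mono σ h))
      (fun f x a => by
        refine (c.leg_map_apply f x _).trans ?_
        exact congrArg (c.leg _ x) (Variety.app_op (G.map f) σ a))
  choose op op_mono op_leg using @key
  have hrep : ∀ {n : ℕ} (p : Fin n → c.pt), ∃ d x, ∃ a : Fin n → (G.obj d).obj,
      (fun i => c.leg d x (a i)) = p := fun {n} p => (hpow n).exists_rep p
  let C : OrderedAlgebra S := ⟨c.pt, fun σ => op σ, fun σ => op_mono σ⟩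
  have eval_leg : ∀ d x (a : ℕ → (G.obj d).obj) (t : OrderedTerm S),
      t.eval C (fun i => c.leg d x (a i)) = c.leg d x (t.eval (G.obj d).obj a) := by
    intro d x a t
    induction t with
    | var i => rfl
    | op σ args ih =>
      simp only [OrderedTerm.eval, ih]
      exact op_leg σ d x _
  have hC : satisfies E C := by
    intro e he a
    obtain ⟨N₁, h₁⟩ := e.1.exists_eval_congr
    obtain ⟨N₂, h₂⟩ := e.2.exists_eval_congr
    let N := max N₁ N₂
    -- All variables up to the largest relevant one are represented at a common object of `D`.
    obtain ⟨d, x, b, hb⟩ := hrep fun i : Fin (N + 1) => a i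
    have hb' : ∀ i ≤ N, a i = c.leg d x (b (Fin.ofNat (N + 1) i)) := fun i hi => by
      have := congrFun hb (Fin.ofNat (N + 1) i)
      simp only [Fin.val_ofNat, Nat.mod_eq_of_lt (Nat.lt_succ_of_le hi)] at this
      exact this.symm
    rw [h₁ C a _ fun i hi => hb' i (hi.trans (le_max_left _ _)),
      h₂ C a _ fun i hi => hb' i (hi.trans (le_max_right _ _)), eval_leg, eval_leg]
    exact (c.leg d x).hom.monotone ((G.obj d).property e he _)
  let c' : WeightedCocone W G :=
    { pt := ⟨C, hC⟩
      leg := fun d x => Variety.mkHom (B := ⟨C, hC⟩) (c.leg d x) (c.leg d x).hom.monotone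
        fun σ a => (op_leg σ d x a).symm
      leg_mono := fun d _ _ h => c.leg_mono d h
      naturality := fun f x => Variety.hom_ext fun a => c.leg_map_apply f x a }
  refine ⟨c', ⟨fun s => ?_, fun {X} g g' h => ?_⟩, hc⟩
  · obtain ⟨g, hg⟩ := hc.exists_desc (s.map (forgetPos E))
    have hg' : ∀ d x a, g (c.leg d x a) = Variety.app (s.leg d x) a := fun d x a =>
      congrArg (fun k : (G ⋙ forgetPos E).obj d ⟶ (s.map (forgetPos E)).pt => k a) (hg d x)
    refine ⟨Variety.mkHom (A := ⟨C, hC⟩) g g.hom.monotone fun {n} σ p => ?_, fun d x =>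
      Variety.hom_ext fun a => hg' d x a⟩
    obtain ⟨d, x, a, rfl⟩ := hrep p
    refine (congrArg g (op_leg σ d x a)).trans ((hg' d x _).trans ?_)
    refine (Variety.app_op (s.leg d x) σ a).trans ?_
    exact congrArg (s.pt.obj.op σ) (funext fun i => (hg' d x (a i)).symm)
  · exact hc.le_of_legs ((forgetPos E).map g) ((forgetPos E).map g') h

theorem hasSiftedColimits_variety : HasSiftedColimits.{u} (Variety E) :=
  fun _ _ _ _ _ _ hW => hW.exists_colimit.imp fun _ h => h.1

theorem preservesSiftedColimits_forgetPos : PreservesSiftedColimits.{u} (forgetPos E) := by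
  intro D _ _ W G _ hW c hc
  obtain ⟨c', hc', h⟩ := hW.exists_colimit (G := G)
  obtain ⟨e, he⟩ := hc'.exists_iso hc
  refine h.of_iso (Iso.refl _) ((forgetPos E).mapIso e) fun d x => ?_
  rw [Iso.refl_hom, NatTrans.id_app, Category.id_comp]
  exact ((forgetPos E).map_comp _ _).symm.trans (congrArg _ (he d x))

variable {c : WeightedCocone W G} {T : Type u} [Finite T]

/-- Every homomorphism from a finitely generated free algebra to a sifted colimit factorizes
through a leg of the colimit cocone. -/
theorem IsSifted.exists_factor (hW : IsSifted W) (hc : c.IsColimit) (y : freeAlgebra E T ⟶ c.pt) :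
    ∃ d x, ∃ y' : freeAlgebra E T ⟶ G.obj d, y' ≫ c.leg d x = y := by
  obtain ⟨n, ⟨e⟩⟩ := Finite.exists_equiv_fin T
  obtain ⟨d, x, a, h⟩ := (hW.pow (preservesSiftedColimits_forgetPos D W G hW c hc) n).exists_rep
    fun i => Variety.app y (freeUnit E (e.symm i))
  refine ⟨d, x, freeLift fun t => a (e t), free_hom_ext fun t => ?_⟩
  have := congrFun h (e t)
  rw [Equiv.symm_apply_apply] at this
  exact this

/-- Homomorphisms from a finitely generated free algebra to a sifted colimit form the colimit of
the posets of homomorphisms to the algebras of the diagram. -/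
theorem IsSifted.exists_desc_hom (hW : IsSifted W) (hc : c.IsColimit)
    {Y : Type w} [PartialOrder Y] (φ : ∀ d, W.obj (.op d) → (freeAlgebra E T ⟶ G.obj d) → Y)
    (mono_left : ∀ d y, Monotone fun x => φ d x y) (mono_right : ∀ d x, Monotone (φ d x))
    (nat : ∀ {d d' : D} (f : d ⟶ d') (x : W.obj (.op d')) (y : freeAlgebra E T ⟶ G.obj d),
      φ d (W.map f.op x) y = φ d' x (y ≫ G.map f)) :
    ∃ g : (freeAlgebra E T ⟶ c.pt) → Y, Monotone g ∧ ∀ d x y, g (y ≫ c.leg d x) = φ d x y := by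
  obtain ⟨n, ⟨e⟩⟩ := Finite.exists_equiv_fin T
  obtain ⟨g, hg, hgφ⟩ :=
    (hW.pow (preservesSiftedColimits_forgetPos D W G hW c hc) n).exists_desc_of_large
      (fun d x (a : Fin n → (G.obj d).obj) => φ d x (freeLift fun t => a (e t)))
      (fun d a => mono_left d _)
      (fun d x _ _ h => mono_right d x (freeLift_mono fun t => h (e t)))
      (fun f x a => (nat f x _).trans (congrArg (φ _ x) (freeLift_comp _ _)))
  refine ⟨fun y => g fun i => Variety.app y (freeUnit E (e.symm i)), fun y y' h => hg fun i => h _,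
    fun d x y => ?_⟩
  refine (hgφ d x fun i => Variety.app y (freeUnit E (e.symm i))).trans (congrArg (φ d x) ?_)
  exact free_hom_ext fun t => by simp

end SiftedColimits

/-! ### Algebras as sifted colimits of finitely generated free algebras -/

section Density

variable {S : ℕ → Type u} {E : Set (OrderedTerm S × OrderedTerm S)}

/-- The free algebra on `n` generators. -/
noncomputable abbrev freeFin (E : Set (OrderedTerm S × OrderedTerm S)) (n : ℕ) : Variety E :=
  freeAlgebra E (ULift.{u} (Fin n))

/-- A small category equivalent to `finiteDiscreteFree E`: its objects are the natural numbers,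
and its morphisms the homomorphisms between the free algebras on so many generators. -/
structure Arity (E : Set (OrderedTerm S × OrderedTerm S)) : Type u where
  n : ℕ

noncomputable instance : Category.{u} (Arity E) where
  Hom a b := freeFin E a.n ⟶ freeFin E b.n
  id a := 𝟙 (freeFin E a.n)
  comp f g := ObjectProperty.homMk (f.hom ≫ g.hom)

/-- A morphism of `Arity E` as a homomorphism of free algebras. -/
noncomputable def Arity.toHom {a b : Arity E} (f : a ⟶ b) : freeFin E a.n ⟶ freeFin E b.n := f

noncomputable instance : PosEnriched (Arity E) where
  homOrder a b := PosEnriched.homOrder (freeFin E a.n) (freeFin E b.n)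
  comp_le_comp h h' := PosEnriched.comp_le_comp (C := Variety E) h h'

/-- The embedding of `Arity E` into the free algebras on finite discrete posets. -/
noncomputable def arityFree (E : Set (OrderedTerm S × OrderedTerm S)) :
    Arity E ⥤ (finiteDiscreteFree E).FullSubcategory where
  obj a := ⟨freeFin E a.n, finiteDiscreteFree_freeAlgebra⟩
  map f := ObjectProperty.homMk (Arity.toHom f)

instance : PosFunctor (arityFree E) where
  map_le h := h

/-- The embedding of `Arity E` into the variety. -/
noncomputable abbrev arityIncl (E : Set (OrderedTerm S × OrderedTerm S)) : Arity E ⥤ Variety E :=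
  arityFree E ⋙ (finiteDiscreteFree E).ι

/-- The weight `n ↦ K(F n, X)` on `Arity E` given by an algebra `X`. -/
noncomputable def nerve (X : Variety E) : (Arity E)ᵒᵖ ⥤ PartOrd.{u} where
  obj a := PartOrd.of (freeFin E a.unop.n ⟶ X)
  map f := PartOrd.ofHom
    ⟨fun x => Arity.toHom f.unop ≫ x, fun _ _ => comp_le_comp_left _⟩

instance (X : Variety E) : PosFunctor (nerve X) where
  map_le h _ := comp_le_comp_right (C := Variety E) h _

/-- The weight given by an algebra is sifted, since the free algebra on `n + m` generators is a
coproduct of the free algebras on `n` and on `m` generators. -/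
theorem isSifted_nerve (X : Variety E) : IsSifted (nerve X) := by
  apply isSifted_of_coproducts
  · exact ⟨⟨0⟩, freeLift fun i => i.down.elim0, fun d x =>
      ⟨freeLift fun i => i.down.elim0, free_hom_ext fun i => i.down.elim0⟩⟩
  · intro d d'
    have lift : ∀ {Y : Variety E} (f : freeFin E d.n ⟶ Y) (f' : freeFin E d'.n ⟶ Y),
        ∃ h : freeFin E (d.n + d'.n) ⟶ Y,
          (freeLift fun i => freeUnit E ⟨i.down.castAdd _⟩) ≫ h = f ∧
          (freeLift fun i => freeUnit E ⟨i.down.natAdd _⟩) ≫ h = f' := by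
      intro Y f f'
      refine ⟨freeLift fun i => Fin.addCases (fun k => Variety.app f (freeUnit E ⟨k⟩))
        (fun k => Variety.app f' (freeUnit E ⟨k⟩)) i.down, ?_, ?_⟩
      · rw [freeLift_comp, ← freeLift_eta f]
        simp
      · rw [freeLift_comp, ← freeLift_eta f']
        simp
    refine ⟨⟨d.n + d'.n⟩, freeLift fun i => freeUnit E ⟨i.down.castAdd _⟩,
      freeLift fun i => freeUnit E ⟨i.down.natAdd _⟩, fun f f' => lift f f', lift, ?_⟩
    intro y y' h h'
    refine free_hom_le fun ⟨i⟩ => ?_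
    induction i using Fin.addCases with
    | left i => exact h (freeUnit E ⟨i⟩)
    | right i => exact h' (freeUnit E ⟨i⟩)

/-- The cocone over the finitely generated free algebras formed by all homomorphisms to `X`. -/
noncomputable def canonicalCocone (X : Variety E) : WeightedCocone (nerve X) (arityIncl E) where
  pt := X
  leg _ x := x
  leg_mono _ _ _ h := h
  naturality _ _ := rfl

/-- Every algebra is a sifted colimit of finitely generated free algebras. A cocone with vertex
`Y` is a family of maps `K(F n, X) → K(F n, Y)`; the one for `n = 1` is a map from `X` to `Y`, and
naturality makes it a homomorphism. -/
theorem canonicalCocone_isColimit (X : Variety E) : (canonicalCocone X).IsColimit where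
  exists_desc s := by
    let pick (x : X.obj) : freeFin E 1 ⟶ X := freeLift fun _ => x
    let g (x : X.obj) : s.pt.obj := Variety.app (s.leg ⟨1⟩ (pick x)) (freeUnit E ⟨0⟩)
    have hg : ∀ (d : Arity E) (x : freeFin E d.n ⟶ X) (p : (freeFin E d.n).obj),
        g (Variety.app x p) = Variety.app (s.leg d x) p := by
      intro d x p
      -- Naturality is applied to the morphism `F 1 ⟶ F d` that picks the element `p`.
      let f : (⟨1⟩ : Arity E) ⟶ d := freeLift fun _ => p
      have h : pick (Variety.app x p) = (nerve X).map f.op x := free_hom_ext fun _ => rfl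
      have := s.naturality f x
      rw [← h] at this
      exact congrArg (fun k => Variety.app k (freeUnit E ⟨0⟩)) this
    refine ⟨Variety.mkHom (A := X) g (fun x y h => ?_) fun {n} σ a => ?_, fun d x =>
      Variety.hom_ext (hg d x)⟩
    · exact s.leg_mono ⟨1⟩ (freeLift_mono fun _ => h) (freeUnit E ⟨0⟩)
    · let x : freeFin E n ⟶ X := freeLift fun i => a i.down
      have hx := hg ⟨n⟩ x
      have h : Variety.app x ((freeFin E n).obj.op σ fun i => freeUnit E ⟨i⟩) = X.obj.op σ a :=
        Variety.app_op x σ _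
      rw [← h, hx]
      refine (Variety.app_op (s.leg ⟨n⟩ x) σ _).trans ?_
      exact congrArg (s.pt.obj.op σ) (funext fun i => (hx (freeUnit E ⟨i⟩)).symm)
  le_of_legs g g' h x :=
    h ⟨1⟩ (freeLift fun _ => x) (freeUnit E ⟨0⟩)

theorem exists_iso_arityFree (A : (finiteDiscreteFree E).FullSubcategory) :
    ∃ n : Arity E, Nonempty (A ≅ (arityFree E).obj n) := by
  obtain ⟨n, η, hη⟩ := A.property
  obtain ⟨f, hf⟩ := hη.exists_ext (freeFin E n) fun i => freeUnit E ⟨i⟩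
  let g : freeFin E n ⟶ A.obj := freeLift fun i => η i.down
  have hfg : f ≫ g = 𝟙 A.obj :=
    le_antisymm (hη.le_of_unit_le _ _ fun i => (congrArg (Variety.app g) (hf i)).le)
      (hη.le_of_unit_le _ _ fun i => (congrArg (Variety.app g) (hf i)).ge)
  have hgf : g ≫ f = 𝟙 (freeFin E n) := free_hom_ext fun i => hf i.down
  exact ⟨⟨n⟩, ⟨(finiteDiscreteFree E).isoMk ⟨f, g, hfg, hgf⟩⟩⟩

end Density

/-! ### Extension of functors along sifted colimits -/

section Extension

universe w v

variable {S : ℕ → Type u} {E : Set (OrderedTerm S × OrderedTerm S)}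
  {L : Type v} [Category.{w} L] [PosEnriched L]

section Existence

variable {F : (finiteDiscreteFree E).FullSubcategory ⥤ L}
  (c : ∀ X : Variety E, WeightedCocone (nerve X) (arityFree E ⋙ F)) (hc : ∀ X, (c X).IsColimit)

include hc in
theorem exists_extension_map {X Y : Variety E} (f : X ⟶ Y) : ∃ g : (c X).pt ⟶ (c Y).pt,
    ∀ (a : Arity E) (x : freeFin E a.n ⟶ X), (c X).leg a x ≫ g = (c Y).leg a (x ≫ f) :=
  (hc X).exists_desc_of (fun a x => (c Y).leg a ((x : freeFin E a.n ⟶ X) ≫ f))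
    (fun a _ _ h => (c Y).leg_mono a (comp_le_comp_right (C := Variety E) h f))
    (fun {_ b} k x => (c Y).naturality k ((x : freeFin E b.n ⟶ X) ≫ f))

/-- The extension of `F` to the variety: the algebra `X` is sent to the colimit of `F` weighted by
`nerve X`. -/
noncomputable def extension : Variety E ⥤ L where
  obj X := (c X).pt
  map f := (exists_extension_map c hc f).choose
  map_id X := (hc X).hom_ext fun a x =>
    ((exists_extension_map c hc (𝟙 X)).choose_spec a x).trans (Category.comp_id _).symm
  map_comp {X Y Z} f g := (hc X).hom_ext fun a x => by
    refine ((exists_extension_map c hc (f ≫ g)).choose_spec a x).trans ?_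
    rw [← Category.assoc, (exists_extension_map c hc f).choose_spec a x]
    exact ((exists_extension_map c hc g).choose_spec a (x ≫ f)).symm

/-- The legs of the colimits that define the extension. -/
noncomputable def extensionLeg {X : Variety E} (a : Arity E) (x : freeFin E a.n ⟶ X) :
    F.obj ((arityFree E).obj a) ⟶ (extension c hc).obj X :=
  (c X).leg a x

theorem extensionLeg_mono {X : Variety E} (a : Arity E) :
    Monotone (extensionLeg c hc a : (freeFin E a.n ⟶ X) → _) :=
  (c X).leg_mono a

theorem extensionLeg_naturality {X : Variety E} {a b : Arity E} (f : a ⟶ b)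
    (x : freeFin E b.n ⟶ X) : extensionLeg c hc a (Arity.toHom f ≫ x) =
      F.map ((arityFree E).map f) ≫ extensionLeg c hc b x :=
  (c X).naturality f x

theorem extensionLeg_map {X Y : Variety E} (f : X ⟶ Y) (a : Arity E) (x : freeFin E a.n ⟶ X) :
    extensionLeg c hc a x ≫ (extension c hc).map f = extensionLeg c hc a (x ≫ f) :=
  (exists_extension_map c hc f).choose_spec a x

theorem extension_le {X : Variety E} {Y : L} {g g' : (extension c hc).obj X ⟶ Y}
    (h : ∀ (a : Arity E) (x : freeFin E a.n ⟶ X),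
      extensionLeg c hc a x ≫ g ≤ extensionLeg c hc a x ≫ g') :
    g ≤ g' :=
  (hc X).le_of_legs g g' h

theorem extension_hom_ext {X : Variety E} {Y : L} {g g' : (extension c hc).obj X ⟶ Y}
    (h : ∀ (a : Arity E) (x : freeFin E a.n ⟶ X),
      extensionLeg c hc a x ≫ g = extensionLeg c hc a x ≫ g') :
    g = g' :=
  (hc X).hom_ext h

theorem exists_extension_desc {X : Variety E} {Y : L}
    (φ : ∀ a : Arity E, (freeFin E a.n ⟶ X) → (F.obj ((arityFree E).obj a) ⟶ Y))
    (mono : ∀ a, Monotone (φ a))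
    (nat : ∀ {a b : Arity E} (f : a ⟶ b) (x : freeFin E b.n ⟶ X),
      φ a (Arity.toHom f ≫ x) = F.map ((arityFree E).map f) ≫ φ b x) :
    ∃ g : (extension c hc).obj X ⟶ Y, ∀ a x, extensionLeg c hc a x ≫ g = φ a x :=
  (hc X).exists_desc_of φ mono nat

instance : PosFunctor (extension c hc) where
  map_le h := extension_le c hc fun a x => by
    rw [extensionLeg_map, extensionLeg_map]
    exact extensionLeg_mono c hc a (comp_le_comp_left x h)

/-- The extension preserves sifted colimits since the weights `nerve X` do: colimits commute with
colimits. -/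
theorem preservesSiftedColimits_extension : PreservesSiftedColimits.{u} (extension c hc) := by
  intro D _ _ W G _ hW k hk
  constructor
  · intro s
    have key := fun a : Arity E => hW.exists_desc_hom hk
      (fun d x (y : freeFin E a.n ⟶ G.obj d) =>
        extensionLeg c hc a y ≫ (show (extension c hc).obj (G.obj d) ⟶ s.pt from s.leg d x))
      (fun d y _ _ h => comp_le_comp_left _ (s.leg_mono d h))
      (fun d x _ _ h => comp_le_comp_right (extensionLeg_mono c hc a h) _)
      (fun f x y => by
        rw [← extensionLeg_map, Category.assoc]
        exact congrArg (_ ≫ ·) (s.naturality f x))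
    -- The naturality of `φ` is checked on homomorphisms that factorize through a leg.
    choose φ φ_mono hφ using key
    obtain ⟨g, hg⟩ := exists_extension_desc c hc φ φ_mono (fun {a b} f y => by
      obtain ⟨d, x, y', rfl⟩ := hW.exists_factor hk y
      rw [← Category.assoc, hφ, hφ, extensionLeg_naturality, Category.assoc])
    refine ⟨g, fun d x => extension_hom_ext c hc fun a y => ?_⟩
    refine Eq.trans ?_ (hφ a d x y)
    rw [← hg, ← extensionLeg_map, Category.assoc]
    rfl
  · intro X g g' h
    refine extension_le c hc fun a y => ?_
    obtain ⟨d, x, y', rfl⟩ := hW.exists_factor hk y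
    rw [← extensionLeg_map]
    refine (Category.assoc _ _ g).le.trans (le_trans ?_ (Category.assoc _ _ g').ge)
    exact comp_le_comp_left _ (h d x)

/-- The extension restricts to `F`: an isomorphism of a free algebra `A` with the free algebra on
`n` generators is a universal element of the weight `nerve A`. -/
theorem extension_restrict [PosFunctor F] :
    Nonempty ((finiteDiscreteFree E).ι ⋙ extension c hc ≅ F) := by
  have hd : ∀ A : (finiteDiscreteFree E).FullSubcategory,
      ∃ g : (extension c hc).obj A.obj ⟶ F.obj A,
        ∀ a (x : (arityFree E).obj a ⟶ A), extensionLeg c hc a x.hom ≫ g = F.map x := fun A => by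
    obtain ⟨g, hg⟩ := exists_extension_desc c hc (X := A.obj)
      (fun a x => F.map (ObjectProperty.homMk x : (arityFree E).obj a ⟶ A))
      (fun a _ _ h => PosFunctor.map_le (F := F) h)
      (fun f x => F.map_comp ((arityFree E).map f) (ObjectProperty.homMk x))
    exact ⟨g, fun a x => hg a x.hom⟩
  choose g hg using hd
  have hiso : ∀ A, IsIso (g A) := fun A => by
    -- The inverse is the leg at an isomorphism of `A` with some `F n`.
    obtain ⟨b, ⟨e⟩⟩ := exists_iso_arityFree A
    refine ⟨F.map e.hom ≫ extensionLeg c hc b e.inv.hom,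
      extension_hom_ext c hc fun a x => ?_, ?_⟩
    · let x' : (arityFree E).obj a ⟶ A := ObjectProperty.homMk x
      let f : a ⟶ b := (x' ≫ e.hom).hom
      have hx : Arity.toHom f ≫ e.inv.hom = x := by
        change ((x' ≫ e.hom) ≫ e.inv).hom = x'.hom
        rw [Category.assoc, e.hom_inv_id, Category.comp_id]
      have hF : F.map ((arityFree E).map f) = F.map x' ≫ F.map e.hom := F.map_comp x' e.hom
      have hleg := extensionLeg_naturality c hc f e.inv.hom
      rw [hx, hF, Category.assoc, ← hg A a x', Category.assoc] at hleg
      exact hleg.symm.trans (Category.comp_id _).symm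
    · rw [Category.assoc, hg, ← F.map_comp, e.hom_inv_id, F.map_id]
  refine ⟨NatIso.ofComponents (fun A => @asIso _ _ _ _ (g A) (hiso A)) fun {A B} f =>
    extension_hom_ext c hc fun a x => ?_⟩
  have h1 : extensionLeg c hc a x ≫ g A = F.map (ObjectProperty.homMk x) :=
    hg A a (ObjectProperty.homMk x)
  have h2 : extensionLeg c hc a (x ≫ f.hom) ≫ g B = F.map (ObjectProperty.homMk x ≫ f) :=
    hg B a (ObjectProperty.homMk x ≫ f)
  calc extensionLeg c hc a x ≫ (extension c hc).map f.hom ≫ g B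
      = extensionLeg c hc a (x ≫ f.hom) ≫ g B := by rw [← Category.assoc, extensionLeg_map]
    _ = extensionLeg c hc a x ≫ g A ≫ F.map f := by
      rw [h2, F.map_comp, ← h1, Category.assoc]

end Existence

variable {H H' : Variety E ⥤ L} [PosFunctor H]

theorem canonicalCocone_map_isColimit (hH : PreservesSiftedColimits.{u} H) (X : Variety E) :
    ((canonicalCocone X).map H).IsColimit :=
  hH _ _ _ (isSifted_nerve X) _ (canonicalCocone_isColimit X)

/-- A transformation between the restrictions to free algebras extends to the colimits. -/
theorem exists_lift_natTrans [PosFunctor H'] (hH : PreservesSiftedColimits.{u} H)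
    (α : (finiteDiscreteFree E).ι ⋙ H ⟶ (finiteDiscreteFree E).ι ⋙ H') :
    ∃ β : H ⟶ H', ∀ A : (finiteDiscreteFree E).FullSubcategory, β.app A.obj = α.app A := by
  have key : ∀ X : Variety E, ∃ g : H.obj X ⟶ H'.obj X,
      ∀ a (x : (arityIncl E).obj a ⟶ X),
        H.map x ≫ g = α.app ((arityFree E).obj a) ≫ H'.map x := fun X =>
    (canonicalCocone_map_isColimit hH X).exists_desc_of
      (fun a (x : (arityIncl E).obj a ⟶ X) => α.app ((arityFree E).obj a) ≫ H'.map x)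
      (fun a _ _ h => comp_le_comp_left _ (PosFunctor.map_le (F := H') h))
      (fun {a b} f x => by
        have h1 := α.naturality ((arityFree E).map f)
        have h2 := H'.map_comp ((arityIncl E).map f) x
        refine (congrArg (α.app _ ≫ ·) h2).trans ?_
        refine (Category.assoc _ _ _).symm.trans (Eq.trans ?_ (Category.assoc _ _ _))
        exact congrArg (· ≫ H'.map _) h1.symm)
  choose g hg using key
  have hext : ∀ (X : Variety E) {Z : L} {p q : H.obj X ⟶ Z},
      (∀ a (x : (arityIncl E).obj a ⟶ X), H.map x ≫ p = H.map x ≫ q) → p = q := fun X _ _ _ h =>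
    (canonicalCocone_map_isColimit hH X).hom_ext h
  refine ⟨⟨g, fun X Y f => hext X fun a x => ?_⟩, fun A => hext _ fun a x => ?_⟩
  · rw [← Category.assoc, ← Category.assoc, ← H.map_comp, hg, hg, Category.assoc, ← H'.map_comp]
  · rw [hg]
    exact (α.naturality (ObjectProperty.homMk x : (arityFree E).obj a ⟶ A)).symm

theorem natTrans_le_of_restrict_le (hH : PreservesSiftedColimits.{u} H) {β β' : H ⟶ H'}
    (h : ∀ A : (finiteDiscreteFree E).FullSubcategory, β.app A.obj ≤ β'.app A.obj)
    (X : Variety E) : β.app X ≤ β'.app X :=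
  (canonicalCocone_map_isColimit hH X).le_of_legs _ _ fun n x => by
    have h1 := β.naturality (show (arityIncl E).obj n ⟶ X from x)
    have h2 := β'.naturality (show (arityIncl E).obj n ⟶ X from x)
    refine h1.le.trans (le_trans ?_ h2.ge)
    exact comp_le_comp_right (h ((arityFree E).obj n)) _

theorem nonempty_iso_of_restrict [PosFunctor H'] (hH : PreservesSiftedColimits.{u} H)
    (hH' : PreservesSiftedColimits.{u} H')
    (α : (finiteDiscreteFree E).ι ⋙ H ≅ (finiteDiscreteFree E).ι ⋙ H') : Nonempty (H ≅ H') := by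
  obtain ⟨β, hβ⟩ := exists_lift_natTrans hH α.hom
  obtain ⟨γ, hγ⟩ := exists_lift_natTrans hH' α.inv
  have ext : ∀ {K : Variety E ⥤ L} [PosFunctor K], PreservesSiftedColimits.{u} K →
      ∀ δ : K ⟶ K, (∀ A : (finiteDiscreteFree E).FullSubcategory, δ.app A.obj = 𝟙 _) → δ = 𝟙 K :=
    fun hK δ hδ => NatTrans.ext (funext fun X => le_antisymm
      (natTrans_le_of_restrict_le hK (β := δ) (β' := 𝟙 _) (fun A => (hδ A).le) X)
      (natTrans_le_of_restrict_le hK (β := 𝟙 _) (β' := δ) (fun A => (hδ A).ge) X))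
  refine ⟨⟨β, γ, ext hH _ fun A => ?_, ext hH' _ fun A => ?_⟩⟩
  · rw [NatTrans.comp_app, hβ, hγ]
    exact α.hom_inv_id_app A
  · rw [NatTrans.comp_app, hβ, hγ]
    exact α.inv_hom_id_app A

theorem isFreeSiftedCompletion_variety (E : Set (OrderedTerm S × OrderedTerm S)) :
    IsFreeSiftedCompletion.{u, w, v} (finiteDiscreteFree E).ι where
  hasSiftedColimits := hasSiftedColimits_variety
  full g := ⟨ObjectProperty.homMk g, rfl⟩
  map_le_map_iff _ _ := Iff.rfl
  exists_extension L _ _ hL F _ := by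
    choose c hc using fun X : Variety E =>
      hL (Arity E) (nerve X) (arityFree E ⋙ F) (isSifted_nerve X)
    exact ⟨extension c hc, inferInstance, preservesSiftedColimits_extension c hc,
      extension_restrict c hc⟩
  extension_unique _ _ _ _ _ _ _ _ hH hH' := fun ⟨α⟩ => nonempty_iso_of_restrict hH hH' α
  exists_lift _ _ _ _ _ _ _ _ hH _ α := exists_lift_natTrans hH α
  le_of_restrict_le _ _ _ _ _ _ _ _ hH _ _ _ h := natTrans_le_of_restrict_le hH h

end Extension

/-! ### Algebras as reflexive coinserters of free algebras -/

section Generation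

variable {S : ℕ → Type u} {E : Set (OrderedTerm S × OrderedTerm S)}

/-- The poset of finite subsets of `T` as an enriched category. Its hom-sets have at most one
element, so their order is the trivial one. -/
instance {T : Type u} : PosEnriched (Finset T) where
  homOrder _ _ :=
    { le := fun _ _ => True
      le_refl := fun _ => trivial
      le_trans := fun _ _ _ _ _ => trivial
      le_antisymm := fun _ _ _ _ => Subsingleton.elim _ _ }
  comp_le_comp _ _ := trivial

/-- The diagram of the free algebras on the finite subsets of `T`. -/
noncomputable def freeOnFinsets (E : Set (OrderedTerm S × OrderedTerm S)) (T : Type u) :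
    Finset T ⥤ Variety E where
  obj s := freeAlgebra E s
  map f := freeLift fun t => freeUnit E ⟨t.1, leOfHom f t.2⟩
  map_id _ := free_hom_ext fun _ => rfl
  map_comp _ _ := free_hom_ext fun _ => rfl

instance {T : Type u} : PosFunctor (freeOnFinsets E T) where
  map_le {_ _ f g} _ := (congrArg _ (Subsingleton.elim f g)).le

/-- The free algebra on `T` as a cocone over the free algebras on the finite subsets of `T`. -/
noncomputable def freeOnFinsetsCocone (E : Set (OrderedTerm S × OrderedTerm S)) (T : Type u) :
    WeightedCocone (unitDiagram (Finset T)ᵒᵖ) (freeOnFinsets E T) where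
  pt := freeAlgebra E T
  leg _ _ := freeLift fun t => freeUnit E t.1
  leg_mono _ _ _ _ := le_rfl
  naturality _ _ := free_hom_ext fun _ => rfl

theorem freeOnFinsetsCocone_isColimit (T : Type u) : (freeOnFinsetsCocone E T).IsColimit where
  exists_desc s := by
    refine ⟨freeLift fun t => Variety.app (s.leg {t} PUnit.unit)
      (freeUnit E ⟨t, Finset.mem_singleton_self t⟩), fun d x => free_hom_ext fun t => ?_⟩
    have ht : ({t.1} : Finset T) ⟶ d := homOfLE (Finset.singleton_subset_iff.2 t.2)
    exact congrArg (fun k => Variety.app k (freeUnit E ⟨t.1, Finset.mem_singleton_self t.1⟩))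
      (s.naturality ht x)
  le_of_legs g g' h := free_hom_le fun t =>
    h {t} PUnit.unit (freeUnit E ⟨t, Finset.mem_singleton_self t⟩)

/-- The evaluation of the free algebra on the elements of `X` in `X`. -/
noncomputable def counit (X : Variety E) : freeAlgebra E X.obj ⟶ X := freeLift id

/-- Every algebra `X` is a reflexive coinserter of free algebras: the elements of the free algebra
on the set `X` are subjected to all inequalities that hold between their values in `X`. -/
theorem isReflexiveCoinserter_counit (X : Variety E) :
    let R := {p : (freeAlgebra E X.obj).obj × (freeAlgebra E X.obj).obj //
      Variety.app (counit X) p.1 ≤ Variety.app (counit X) p.2}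
    IsReflexiveCoinserter (freeLift fun r : R => r.1.1) (freeLift fun r : R => r.1.2)
      (counit X) := by
  intro R
  refine ⟨⟨freeLift fun x => freeUnit E ⟨(freeUnit E x, freeUnit E x), le_rfl⟩,
    free_hom_ext fun _ => rfl, free_hom_ext fun _ => rfl⟩, ⟨free_hom_le fun r => r.2, ?_, ?_⟩⟩
  · intro Z h hle
    -- `h` factorizes through the surjection `counit X` as it preserves the inequalities in `R`.
    have hh : ∀ p q, Variety.app (counit X) p ≤ Variety.app (counit X) q →
        Variety.app h p ≤ Variety.app h q := fun p q hpq =>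
      hle (freeUnit E (⟨(p, q), hpq⟩ : R))
    have hh' : ∀ p, Variety.app h (freeUnit E (Variety.app (counit X) p)) = Variety.app h p :=
      fun p => le_antisymm (hh _ _ le_rfl) (hh _ _ le_rfl)
    refine ⟨Variety.mkHom (fun x => Variety.app h (freeUnit E x)) (fun x y hxy => hh _ _ hxy)
      fun σ a => ?_, Variety.hom_ext hh'⟩
    have hσ : Variety.app (counit X) ((freeAlgebra E X.obj).obj.op σ fun i => freeUnit E (a i)) =
        X.obj.op σ a := Variety.app_op (counit X) σ _
    rw [← hσ, hh', Variety.app_op]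
  · intro Z g g' h x
    exact h (freeUnit E x)

theorem isClosureOf_finiteDiscreteFree (E : Set (OrderedTerm S × OrderedTerm S)) :
    IsClosureOf.{u} (finiteDiscreteFree E) := by
  intro Q hP hcoins hfilt _ X
  have hfree : ∀ T : Type u, Q (freeAlgebra E T) := fun T =>
    hfilt (Finset T) (freeOnFinsets E T) (freeOnFinsetsCocone E T)
      (freeOnFinsetsCocone_isColimit T) fun _ => hP _ finiteDiscreteFree_freeAlgebra
  exact hcoins _ _ _ (isReflexiveCoinserter_counit X) (hfree _) (hfree _)

end Generation

end PosCat

theorem theorem5p12 {S : ℕ → Type u}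
    (E : Set (PosCat.OrderedTerm S × PosCat.OrderedTerm S)) :
    PosCat.IsFreeSiftedCompletion.{u, wL, vL} (PosCat.finiteDiscreteFree E).ι ∧
      PosCat.IsClosureOf.{u} (PosCat.finiteDiscreteFree E) :=
  ⟨PosCat.isFreeSiftedCompletion_variety E, PosCat.isClosureOf_finiteDiscreteFree E⟩
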